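/- Let $\Bbbk$ be an algebraically closed field of characteristic $0$, let $n\ge 1$, and let $G=\mathbb Z_{2n}\times\mathbb Z_2=\langle a,b\mid a^{2n}=b^2=1,\ ab=ba\rangle$. Let $\mathbb Z_2=\{1,x\}$ act on $G$ by automorphisms with $a\triangleleft x=ab$ and $b\triangleleft x=b$. Let $\sigma:G\to\Bbbk^\times$ satisfy $\sigma(g\triangleleft x)=\sigma(g)$ and $\sigma(1)=1$, and let $\tau:G\times G\to\Bbbk^\times$ be a unital $2$-cocycle with $\sigma(gh)\sigma(g)^{-1}\sigma(h)^{-1}=\tau(g,h)\,\tau(g\triangleleft x,h\triangleleft x)$ for all $g,h\in G$. Let $H=K(8n,\sigma,\tau)$ be the Hopf algebra $\Bbbk^G\#_{\sigma,\tau}\Bbbk\mathbb Z_2$: it has basis $\{e_g,\,e_gx\}_{g\in G}$, relations $e_ge_h=\delta_{g,h}e_g$, $xe_g=e_{g\triangleleft x}x$, $x^2=\sum_g\sigma(g)e_g$, and coproduct $\Delta(e_g)=\sum_{hk=g}e_h\otimes e_k$, $\Delta(x)=\bigl[\sum_{g,h}\tau(g,h)e_g\otimes e_h\bigr](x\otimes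 x)$; the counit is $\epsilon(e_g)=\delta_{g,1}$, $\epsilon(x)=1$, and the antipode is $\mathcal S(e_g)=e_{g^{-1}}$, $\mathcal S(x)=\sum_g\sigma(g)^{-1}\tau(g,g^{-1})^{-1}e_{g\triangleleft x}x$. A quasitriangular structure on $H$ is an invertible $R\in H\otimes H$ with $(\Delta\otimes\mathrm{id})(R)=R_{13}R_{23}$, $(\mathrm{id}\otimes\Delta)(R)=R_{13}R_{12}$ and $\Delta^{op}(y)R=R\Delta(y)$ for all $y\in H$. It is minimal if $H=H_lH_r$, where $H_l=\{(f\otimes\mathrm{id})(R)\mid f\in H^*\}$ and $H_r=\{(\mathrm{id}\otimes f)(R)\mid f\in H^*\}$. $H$ is called minimal if it has a minimal quasitriangular structure. Put $\eta(g,h)=\tau(g,h)\tau(h,g)^{-1}$ and assume $\eta(a,b)=1$. Then: (1) $K(8n,\sigma,\tau)$ is not minimal, that is, no quasitriangular structure on it is minimal. (2) Put $P_i=\prod_{k=1}^{i-1}\tau(a,a^k)$ (so $P_0=P_1=1$), $\lambda_{m,j}=P_m^{-1}\sigma(a^j)^{\lfloor m/2\rfloor}$ and $h(t_1,t_2)=\tau(t_1,t_2)/\tau(t_2\triangleleft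 x,t_1\triangleleft x)$. Let $\alpha,\beta\in\Bbbk$ satisfy $(\alpha\beta)^n\lambda_{2n,1}=1$ and $\beta^2/\alpha^2=\tau(b,b)/\tau(b,a)^2$, and put $S_{j,0}=\lambda_{2j+1,1}\alpha^{j+1}\beta^j$, $S_{j,1}=h(a,a^{2j+1}b)\lambda_{2j+1,1}\alpha^j\beta^{j+1}$. With $S=\{s\in G\mid s\triangleleft x=s\}$ and $T=G\setminus S$ let $$R'_{\alpha,\beta}=\sum_{s,s'\in S}w^1(s,s')e_s\otimes e_{s'}+\sum_{s\in S,t\in T}w^2(s,t)e_sx\otimes e_t+\sum_{t\in T,s\in S}w^3(t,s)e_t\otimes e_sx+\sum_{t,t'\in T}w^4(t,t')e_tx\otimes e_{t'}x,$$ where for $0\le i,j\le n-1$ and $p,q\in\{0,1\}$: $$w^1(a^{2i}b^p,a^{2j}b^q)=(\lambda_{2j,1})^{2i}(\alpha\beta)^{2ij}\sigma(a^{2j})^i,$$ $$w^2(a^{2i}b^p,a^{2j+1}b^q)=\Bigl(\tfrac{\tau(b,a)\beta}{\tau(b,a^{2i})\alpha}\Bigr)^{p}\lambda_{2i,2j+1}(S_{j,0}S_{j,1})^i,\qquad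 w^3(a^{2i+1}b^p,a^{2j}b^q)=\Bigl(\tfrac{\tau(b,a)\beta}{\tau(b,a^{2j})\alpha}\Bigr)^{q}\lambda_{2j,2i+1}(S_{i,0}S_{i,1})^j,$$ $$w^4(a^{2i+1},a^{2j+1})=\lambda_{2i+1,2j+1}S_{j,0}^{i+1}S_{j,1}^i,\qquad w^4(a^{2i+1},a^{2j+1}b)=\lambda_{2i+1,2j+1}S_{j,0}^{i}S_{j,1}^{i+1},$$ $$w^4(a^{2i+1}b,a^{2j+1})=h(a^{2i+1}b,a^{2j+1})\lambda_{2i+1,2j+1}S_{j,0}^{i}S_{j,1}^{i+1},\qquad w^4(a^{2i+1}b,a^{2j+1}b)=h(a^{2i+1}b,a^{2j+1}b)\lambda_{2i+1,2j+1}S_{j,0}^{i+1}S_{j,1}^{i}.$$ Then the $w^1$ block $(w^1(s,s'))_{s,s'\in S}$ of $R'_{\alpha,\beta}$ is a degenerate matrix, i.e. its determinant is $0$. -/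

import Mathlib

open scoped TensorProduct

/-! ## Quasitriangular structures and minimality -/

namespace Quasitriangular

section

variable {k H : Type*} [Field k] [Ring H] [HopfAlgebra k H]

/-- `R ↦ R₁₂ = ∑ R⁽¹⁾ ⊗ R⁽²⁾ ⊗ 1`. -/
noncomputable def leg12 : H ⊗[k] H →ₐ[k] (H ⊗[k] H) ⊗[k] H :=
  Algebra.TensorProduct.includeLeft

/-- `R ↦ R₁₃ = ∑ R⁽¹⁾ ⊗ 1 ⊗ R⁽²⁾`. -/
noncomputable def leg13 : H ⊗[k] H →ₐ[k] (H ⊗[k] H) ⊗[k] H :=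
  Algebra.TensorProduct.map Algebra.TensorProduct.includeLeft (AlgHom.id k H)

/-- `R ↦ R₂₃ = ∑ 1 ⊗ R⁽¹⁾ ⊗ R⁽²⁾`. -/
noncomputable def leg23 : H ⊗[k] H →ₐ[k] (H ⊗[k] H) ⊗[k] H :=
  Algebra.TensorProduct.map Algebra.TensorProduct.includeRight (AlgHom.id k H)

/-- `R` is a universal `R`-matrix of (a quasitriangular structure on) the Hopf algebra `H`. -/
structure IsUniversalRMatrix (R : H ⊗[k] H) : Prop where
  isUnit : IsUnit R
  /-- `(Δ ⊗ id)(R) = R₁₃ R₂₃` -/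
  comul_id : (Coalgebra.comul (R := k) (A := H)).rTensor H R = leg13 R * leg23 R
  /-- `(id ⊗ Δ)(R) = R₁₃ R₁₂` -/
  id_comul : (TensorProduct.assoc k H H H).symm
    ((Coalgebra.comul (R := k) (A := H)).lTensor H R) = leg13 R * leg12 R
  /-- `Δᵒᵖ(h) R = R Δ(h)` -/
  comul_op : ∀ h : H, TensorProduct.comm k H H (Coalgebra.comul (R := k) h) * R =
    R * Coalgebra.comul (R := k) h

/-- `l(f) = (f ⊗ id)(R)`. -/
noncomputable def lMap (R : H ⊗[k] H) (f : Module.Dual k H) : H :=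
  TensorProduct.lid k H (f.rTensor H R)

/-- `r(f) = (id ⊗ f)(R)`. -/
noncomputable def rMap (R : H ⊗[k] H) (f : Module.Dual k H) : H :=
  TensorProduct.rid k H (f.lTensor H R)

/-- `H_l = {l(f) | f ∈ H*}`. -/
noncomputable def leftSupport (R : H ⊗[k] H) : Submodule k H where
  carrier := Set.range (lMap R)
  zero_mem' := ⟨0, by simp [lMap]⟩
  add_mem' := by
    rintro _ _ ⟨f, rfl⟩ ⟨g, rfl⟩
    exact ⟨f + g, by simp [lMap, LinearMap.rTensor_add]⟩
  smul_mem' := by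
    rintro c _ ⟨f, rfl⟩
    exact ⟨c • f, by simp [lMap, LinearMap.rTensor_smul]⟩

/-- `H_r = {r(f) | f ∈ H*}`. -/
noncomputable def rightSupport (R : H ⊗[k] H) : Submodule k H where
  carrier := Set.range (rMap R)
  zero_mem' := ⟨0, by simp [rMap]⟩
  add_mem' := by
    rintro _ _ ⟨f, rfl⟩ ⟨g, rfl⟩
    exact ⟨f + g, by simp [rMap, LinearMap.lTensor_add]⟩
  smul_mem' := by
    rintro c _ ⟨f, rfl⟩
    exact ⟨c • f, by simp [rMap, LinearMap.lTensor_smul]⟩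

/-- `R` is a minimal quasitriangular structure on `H`: it is a universal `R`-matrix and
`H = H_l H_r` (the span of the products). -/
structure IsMinimal (R : H ⊗[k] H) : Prop where
  isUniversalRMatrix : IsUniversalRMatrix R
  mul_eq_top : leftSupport R * rightSupport R = ⊤

end

/-- `H` is a minimal quasitriangular Hopf algebra: it has a minimal quasitriangular structure. -/
def IsMinimalHopf (k H : Type*) [Field k] [Ring H] [HopfAlgebra k H] : Prop :=
  ∃ R : H ⊗[k] H, IsMinimal R

end Quasitriangular

/-! ## The Hopf algebras `𝕜^G #_{σ,τ} 𝕜ℤ₂` -/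

/-- The data `(G, ◁, σ, τ)`. An injective homomorphism from `ℤ₂ = {1, x}` to `Aut G` is
the same as a nontrivial automorphism `g ↦ g ◁ x` of `G` with square the identity. -/
structure ExtData (k G : Type*) [Field k] [CommGroup G] where
  /-- `act g = g ◁ x` -/
  act : G ≃* G
  act_act : ∀ g, act (act g) = g
  act_ne : ∃ g, act g ≠ g
  σ : G → kˣ
  σ_act : ∀ g, σ (act g) = σ g
  σ_one : σ 1 = 1
  τ : G → G → kˣ
  τ_one_left : ∀ g, τ 1 g = 1
  τ_one_right : ∀ g, τ g 1 = 1
  τ_cocycle : ∀ g h l, τ g h * τ (g * h) l = τ h l * τ g (h * l)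
  σ_τ : ∀ g h, σ (g * h) * (σ g)⁻¹ * (σ h)⁻¹ = τ g h * τ (act g) (act h)

/-- The underlying space of `𝕜^G #_{σ,τ} 𝕜ℤ₂`, with basis `e_g, e_g x` for `g ∈ G`:
`⟨u, v⟩` stands for `∑ g, u g • e_g + ∑ g, v g • (e_g x)`. -/
@[ext] structure ExtAlg {k G : Type*} [Field k] [CommGroup G] (D : ExtData k G) where
  /-- the coefficients of the `e_g` -/
  coE : G → k
  /-- the coefficients of the `e_g x` -/
  coX : G → k

namespace ExtAlg

section

variable {k G : Type*} [Field k] [CommGroup G] {D : ExtData k G}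

theorem _root_.ExtData.σ_mul (D : ExtData k G) (g h : G) : (D.σ (g * h) : k) =
    D.τ g h * D.τ (D.act g) (D.act h) * D.σ g * D.σ h := by
  have H := D.σ_τ g h
  rw [mul_inv_eq_iff_eq_mul, mul_inv_eq_iff_eq_mul] at H
  rw [H]
  push_cast
  ring

theorem _root_.ExtData.τ_inv_comm (D : ExtData k G) (g : G) : D.τ g⁻¹ g = D.τ g g⁻¹ := by
  have h := D.τ_cocycle g g⁻¹ g
  simpa [D.τ_one_left, D.τ_one_right] using h.symm

theorem ext' {u v : ExtAlg D} (h₁ : ∀ g, u.coE g = v.coE g) (h₂ : ∀ g, u.coX g = v.coX g) :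
    u = v := ExtAlg.ext (funext h₁) (funext h₂)

instance : Zero (ExtAlg D) := ⟨⟨0, 0⟩⟩
instance : Add (ExtAlg D) := ⟨fun u v => ⟨u.coE + v.coE, u.coX + v.coX⟩⟩
instance : Neg (ExtAlg D) := ⟨fun u => ⟨-u.coE, -u.coX⟩⟩
instance : SMul k (ExtAlg D) := ⟨fun c u => ⟨c • u.coE, c • u.coX⟩⟩
instance : One (ExtAlg D) := ⟨⟨1, 0⟩⟩

/-- The product determined by `e_g e_h = δ_{g,h} e_g`, `x e_g = e_{g ◁ x} x`,
`x² = ∑ g, σ(g) e_g`. -/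
instance : Mul (ExtAlg D) where
  mul u v := ⟨fun g => u.coE g * v.coE g + u.coX g * v.coX (D.act g) * D.σ g,
    fun g => u.coE g * v.coX g + u.coX g * v.coE (D.act g)⟩

@[simp] theorem coE_zero (g : G) : (0 : ExtAlg D).coE g = 0 := rfl
@[simp] theorem coX_zero (g : G) : (0 : ExtAlg D).coX g = 0 := rfl
@[simp] theorem coE_one (g : G) : (1 : ExtAlg D).coE g = 1 := rfl
@[simp] theorem coX_one (g : G) : (1 : ExtAlg D).coX g = 0 := rfl
@[simp] theorem coE_add (u v : ExtAlg D) (g : G) : (u + v).coE g = u.coE g + v.coE g := rfl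
@[simp] theorem coX_add (u v : ExtAlg D) (g : G) : (u + v).coX g = u.coX g + v.coX g := rfl
@[simp] theorem coE_neg (u : ExtAlg D) (g : G) : (-u).coE g = -u.coE g := rfl
@[simp] theorem coX_neg (u : ExtAlg D) (g : G) : (-u).coX g = -u.coX g := rfl
@[simp] theorem coE_smul (c : k) (u : ExtAlg D) (g : G) : (c • u).coE g = c * u.coE g := rfl
@[simp] theorem coX_smul (c : k) (u : ExtAlg D) (g : G) : (c • u).coX g = c * u.coX g := rfl
@[simp] theorem coE_mul (u v : ExtAlg D) (g : G) :
    (u * v).coE g = u.coE g * v.coE g + u.coX g * v.coX (D.act g) * D.σ g := rfl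
@[simp] theorem coX_mul (u v : ExtAlg D) (g : G) :
    (u * v).coX g = u.coE g * v.coX g + u.coX g * v.coE (D.act g) := rfl

instance : Ring (ExtAlg D) where
  add_assoc u v w := by apply ext' <;> intro g <;> simp <;> ring
  zero_add u := by apply ext' <;> intro g <;> simp
  add_zero u := by apply ext' <;> intro g <;> simp
  add_comm u v := by apply ext' <;> intro g <;> simp <;> ring
  neg_add_cancel u := by apply ext' <;> intro g <;> simp
  nsmul := nsmulRec
  zsmul := zsmulRec
  left_distrib u v w := by apply ext' <;> intro g <;> simp <;> ring
  right_distrib u v w := by apply ext' <;> intro g <;> simp <;> ring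
  zero_mul u := by apply ext' <;> intro g <;> simp
  mul_zero u := by apply ext' <;> intro g <;> simp
  mul_assoc u v w := by apply ext' <;> intro g <;> simp [D.act_act, D.σ_act] <;> ring
  one_mul u := by apply ext' <;> intro g <;> simp
  mul_one u := by apply ext' <;> intro g <;> simp

instance : Module k (ExtAlg D) where
  one_smul u := by apply ext' <;> intro g <;> simp
  mul_smul c d u := by apply ext' <;> intro g <;> simp <;> ring
  smul_zero c := by apply ext' <;> intro g <;> simp
  smul_add c u v := by apply ext' <;> intro g <;> simp <;> ring
  add_smul c d u := by apply ext' <;> intro g <;> simp <;> ring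
  zero_smul u := by apply ext' <;> intro g <;> simp

instance : Algebra k (ExtAlg D) :=
  Algebra.ofModule (fun c u v => by apply ext' <;> intro g <;> simp <;> ring)
    (fun c u v => by apply ext' <;> intro g <;> simp <;> ring)

/-- The functional `E_g` of the basis dual to `{e_g, e_g x}`. -/
def dualE (D : ExtData k G) (g : G) : ExtAlg D →ₗ[k] k where
  toFun u := u.coE g
  map_add' _ _ := rfl
  map_smul' _ _ := rfl

/-- The functional `X_g` of the basis dual to `{e_g, e_g x}`. -/
def dualX (D : ExtData k G) (g : G) : ExtAlg D →ₗ[k] k where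
  toFun u := u.coX g
  map_add' _ _ := rfl
  map_smul' _ _ := rfl

theorem coE_sum {ι : Type*} (s : Finset ι) (f : ι → ExtAlg D) (g : G) :
    (∑ i ∈ s, f i).coE g = ∑ i ∈ s, (f i).coE g := map_sum (dualE D g) f s

theorem coX_sum {ι : Type*} (s : Finset ι) (f : ι → ExtAlg D) (g : G) :
    (∑ i ∈ s, f i).coX g = ∑ i ∈ s, (f i).coX g := map_sum (dualX D g) f s

/-- The generator `x`. -/
def x (D : ExtData k G) : ExtAlg D := ⟨0, 1⟩

@[simp] theorem coE_x (h : G) : (x D).coE h = 0 := rfl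
@[simp] theorem coX_x (h : G) : (x D).coX h = 1 := rfl

theorem mul_eq_iff (h l g : G) : h * l = g ↔ l = h⁻¹ * g := by
  rw [eq_inv_mul_iff_mul_eq]

theorem act_eq_iff (g h : G) : D.act g = h ↔ g = D.act h :=
  ⟨fun H => by rw [← H, D.act_act], fun H => by rw [H, D.act_act]⟩

end

section

set_option linter.unusedSectionVars false

variable {k G : Type*} [Field k] [CommGroup G] [DecidableEq G] {D : ExtData k G}

/-- The basis element `e_g`. -/
def e (D : ExtData k G) (g : G) : ExtAlg D := ⟨Pi.single g 1, 0⟩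

/-- The basis element `e_g x`. -/
def ex (D : ExtData k G) (g : G) : ExtAlg D := ⟨0, Pi.single g 1⟩

@[simp] theorem coE_e (g h : G) : (e D g).coE h = if h = g then 1 else 0 := Pi.single_apply ..
@[simp] theorem coX_e (g h : G) : (e D g).coX h = 0 := rfl
@[simp] theorem coE_ex (g h : G) : (ex D g).coE h = 0 := rfl
@[simp] theorem coX_ex (g h : G) : (ex D g).coX h = if h = g then 1 else 0 :=
  Pi.single_apply ..

theorem e_mul_x (g : G) : e D g * x D = ex D g := by apply ext' <;> intro h <;> simp

theorem x_mul_e (g : G) : x D * e D g = e D (D.act g) * x D := by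
  apply ext' <;> intro h <;> simp [act_eq_iff]

theorem e_mul_e (g h : G) : e D g * e D h = if g = h then e D g else 0 := by
  apply ext' <;> intro l <;> split_ifs <;> simp <;> grind

theorem e_mul_ex (g h : G) : e D g * ex D h = if g = h then ex D g else 0 := by
  rw [← e_mul_x, ← mul_assoc, e_mul_e]; split_ifs <;> simp [e_mul_x]

theorem ex_mul_e (g h : G) : ex D g * e D h = if g = D.act h then ex D g else 0 := by
  rw [← e_mul_x, mul_assoc, x_mul_e, ← mul_assoc, e_mul_e]; split_ifs <;> simp

theorem ex_mul_ex (g h : G) :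
    ex D g * ex D h = if g = D.act h then (D.σ g : k) • e D g else 0 := by
  apply ext' <;> intro l <;> split_ifs <;> simp [act_eq_iff] <;> grind

@[simp] theorem dualE_e (g h : G) : dualE D g (e D h) = if g = h then 1 else 0 :=
  coE_e (D := D) h g
@[simp] theorem dualE_ex (g h : G) : dualE D g (ex D h) = 0 := rfl
@[simp] theorem dualX_e (g h : G) : dualX D g (e D h) = 0 := rfl
@[simp] theorem dualX_ex (g h : G) : dualX D g (ex D h) = if g = h then 1 else 0 :=
  coX_ex (D := D) h g

variable [Fintype G]

theorem x_mul_x : x D * x D = ∑ g, (D.σ g : k) • e D g := by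
  apply ext' <;> intro h <;> simp [coE_sum, coX_sum]

theorem one_eq_sum : (1 : ExtAlg D) = ∑ g, e D g := by
  apply ext' <;> intro h <;> simp [coE_sum, coX_sum]

theorem eq_sum (u : ExtAlg D) :
    u = ∑ g, u.coE g • e D g + ∑ g, u.coX g • ex D g := by
  apply ext' <;> intro h <;> simp [coE_sum, coX_sum]

theorem hom_ext {M : Type*} [AddCommMonoid M] [Module k M] {f f' : ExtAlg D →ₗ[k] M}
    (h₁ : ∀ g, f (e D g) = f' (e D g)) (h₂ : ∀ g, f (ex D g) = f' (ex D g)) : f = f' := by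
  refine LinearMap.ext fun u => ?_
  rw [eq_sum u]
  simp only [map_add, map_sum, map_smul, h₁, h₂]

instance : Module.Finite k (ExtAlg D) :=
  Module.Finite.of_surjective
    ({ toFun := fun p => ⟨p.1, p.2⟩
       map_add' := fun _ _ => rfl
       map_smul' := fun _ _ => rfl } : ((G → k) × (G → k)) →ₗ[k] ExtAlg D)
    (fun u => ⟨(u.coE, u.coX), rfl⟩)

/-- The coproduct: `Δ(e_g) = ∑_{hl = g} e_h ⊗ e_l` and
`Δ(e_g x) = ∑_{hl = g} τ(h,l) e_h x ⊗ e_l x`. -/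
noncomputable def comulMap (D : ExtData k G) : ExtAlg D →ₗ[k] ExtAlg D ⊗[k] ExtAlg D :=
  ∑ h, ∑ l, ((dualE D (h * l)).smulRight (e D h ⊗ₜ[k] e D l) +
    (D.τ h l : k) • (dualX D (h * l)).smulRight (ex D h ⊗ₜ[k] ex D l))

/-- The counit: `ε(e_g) = δ_{g,1}` and `ε(x) = 1`, hence `ε(e_g x) = δ_{g,1}`. -/
def counitMap (D : ExtData k G) : ExtAlg D →ₗ[k] k := dualE D 1 + dualX D 1

/-- The antipode: `S(e_g) = e_{g⁻¹}` and `S(x) = ∑ g, σ(g)⁻¹ τ(g,g⁻¹)⁻¹ e_{g ◁ x} x`, hence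
`S(e_g x) = S(x) S(e_g) = σ(g⁻¹)⁻¹ τ(g⁻¹,g)⁻¹ e_{g⁻¹ ◁ x} x`. -/
def antipodeMap (D : ExtData k G) : ExtAlg D →ₗ[k] ExtAlg D :=
  ∑ g, ((dualE D g).smulRight (e D g⁻¹) +
    (dualX D g).smulRight
      ((((D.σ g⁻¹)⁻¹ * (D.τ g⁻¹ g)⁻¹ : kˣ) : k) • ex D (D.act g⁻¹)))

theorem comulMap_e (g : G) :
    comulMap D (e D g) = ∑ h, e D h ⊗ₜ[k] e D (h⁻¹ * g) := by
  simp [comulMap, LinearMap.sum_apply, mul_eq_iff, ite_smul]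

theorem comulMap_ex (g : G) :
    comulMap D (ex D g) = ∑ h, (D.τ h (h⁻¹ * g) : k) • ex D h ⊗ₜ[k] ex D (h⁻¹ * g) := by
  simp [comulMap, LinearMap.sum_apply, mul_eq_iff, ite_smul, smul_ite]

theorem counitMap_e (g : G) : counitMap D (e D g) = if 1 = g then 1 else 0 := by
  simp [counitMap]

theorem counitMap_ex (g : G) : counitMap D (ex D g) = if 1 = g then 1 else 0 := by
  simp [counitMap]

theorem antipodeMap_e (g : G) : antipodeMap D (e D g) = e D g⁻¹ := by
  simp [antipodeMap, LinearMap.sum_apply, ite_smul]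

theorem antipodeMap_ex (g : G) : antipodeMap D (ex D g) =
    (((D.σ g⁻¹)⁻¹ * (D.τ g⁻¹ g)⁻¹ : kˣ) : k) • ex D (D.act g⁻¹) := by
  simp [antipodeMap, LinearMap.sum_apply, ite_smul]

noncomputable instance : CoalgebraStruct k (ExtAlg D) where
  comul := comulMap D
  counit := counitMap D

theorem comul_def : (Coalgebra.comul : ExtAlg D →ₗ[k] _) = comulMap D := rfl
theorem counit_def : (Coalgebra.counit : ExtAlg D →ₗ[k] k) = counitMap D := rfl

noncomputable instance : Coalgebra k (ExtAlg D) where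
  coassoc := by
    apply hom_ext <;> intro g
    · simp only [comul_def, LinearMap.comp_apply, LinearEquiv.coe_coe, comulMap_e, map_sum,
        LinearMap.rTensor_tmul, LinearMap.lTensor_tmul, TensorProduct.sum_tmul,
        TensorProduct.tmul_sum, TensorProduct.assoc_tmul]
      rw [Finset.sum_comm]
      refine Finset.sum_congr rfl fun p _ => ?_
      rw [← Equiv.sum_comp (Equiv.mulLeft p)]
      simp [mul_assoc]
    · simp only [comul_def, LinearMap.comp_apply, LinearEquiv.coe_coe, comulMap_ex, map_sum,
        map_smul, LinearMap.rTensor_tmul, LinearMap.lTensor_tmul, TensorProduct.sum_tmul,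
        TensorProduct.tmul_sum, TensorProduct.tmul_smul, ← TensorProduct.smul_tmul',
        TensorProduct.assoc_tmul, Finset.smul_sum]
      rw [Finset.sum_comm]
      refine Finset.sum_congr rfl fun p _ => ?_
      rw [← Equiv.sum_comp (Equiv.mulLeft p)]
      refine Finset.sum_congr rfl fun q _ => ?_
      have h := congrArg (Units.val) (D.τ_cocycle p q (q⁻¹ * (p⁻¹ * g)))
      simp only [Units.val_mul, mul_inv_cancel_left] at h
      simp only [Equiv.coe_mulLeft, smul_smul, inv_mul_cancel_left, mul_inv_rev, mul_assoc,
        mul_comm (D.τ (p * q) _ : k), h]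
      rw [mul_comm (D.τ p _ : k)]
  rTensor_counit_comp_comul := by
    apply hom_ext <;> intro g
    · simp [comul_def, counit_def, comulMap_e, counitMap_e, TensorProduct.ite_tmul]
    · simp [comul_def, counit_def, comulMap_ex, counitMap_ex, TensorProduct.ite_tmul, D.τ_one_left]
  lTensor_counit_comp_comul := by
    apply hom_ext <;> intro g
    · simp [comul_def, counit_def, comulMap_e, counitMap_e, TensorProduct.tmul_ite,
        eq_inv_mul_iff_mul_eq]
    · simp [comul_def, counit_def, comulMap_ex, counitMap_ex, TensorProduct.tmul_ite,
        eq_inv_mul_iff_mul_eq, D.τ_one_right]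

theorem comulMap_one : comulMap D (1 : ExtAlg D) = 1 := by
  rw [Algebra.TensorProduct.one_def]
  conv_rhs => rw [one_eq_sum, TensorProduct.sum_tmul]
  simp only [TensorProduct.tmul_sum]
  rw [one_eq_sum, map_sum]
  simp only [comulMap_e]
  rw [Finset.sum_comm]
  refine Finset.sum_congr rfl fun p _ => ?_
  rw [← Equiv.sum_comp (Equiv.mulLeft p)]
  simp

theorem comulMap_mul (u v : ExtAlg D) : comulMap D (u * v) = comulMap D u * comulMap D v := by
  have key : ∀ u' v' : ExtAlg D,
      ((∃ g, u' = e D g) ∨ ∃ g, u' = ex D g) → ((∃ g, v' = e D g) ∨ ∃ g, v' = ex D g) →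
      comulMap D (u' * v') = comulMap D u' * comulMap D v' := by
    rintro _ _ (⟨g, rfl⟩ | ⟨g, rfl⟩) (⟨h, rfl⟩ | ⟨h, rfl⟩)
    · simp only [comulMap_e, e_mul_e, Finset.sum_mul_sum, Algebra.TensorProduct.tmul_mul_tmul,
        TensorProduct.ite_tmul, TensorProduct.tmul_ite, apply_ite (comulMap D), map_zero]
      by_cases H : g = h
      · simp [H]
      · simp only [H, if_false]
        refine (Finset.sum_eq_zero fun p _ => Finset.sum_eq_zero fun q _ => ?_).symm
        split_ifs with h₁ h₂
        · subst h₂; exact absurd (mul_left_cancel h₁) H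
        all_goals simp
    · simp only [comulMap_e, comulMap_ex, e_mul_ex, Finset.sum_mul_sum,
        Algebra.TensorProduct.tmul_mul_tmul, mul_smul_comm,
        TensorProduct.ite_tmul, TensorProduct.tmul_ite, apply_ite (comulMap D), map_zero]
      by_cases H : g = h
      · simp [H]
      · simp only [H, if_false]
        refine (Finset.sum_eq_zero fun p _ => Finset.sum_eq_zero fun q _ => ?_).symm
        split_ifs with h₁ h₂
        · subst h₂; exact absurd (mul_left_cancel h₁) H
        all_goals simp
    · simp only [comulMap_e, comulMap_ex, ex_mul_e, Finset.sum_mul_sum,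
        Algebra.TensorProduct.tmul_mul_tmul, smul_mul_assoc,
        TensorProduct.ite_tmul, TensorProduct.tmul_ite, apply_ite (comulMap D), map_zero]
      by_cases H : g = D.act h
      · simp [H, ← act_eq_iff]
      · simp only [H, if_false]
        refine (Finset.sum_eq_zero fun p _ => Finset.sum_eq_zero fun q _ => ?_).symm
        split_ifs with h₁ h₂
        · subst h₂
          simp only [map_mul, map_inv] at h₁
          exact absurd (mul_left_cancel h₁) H
        all_goals simp
    · simp only [comulMap_e, comulMap_ex, ex_mul_ex, Finset.sum_mul_sum,
        Algebra.TensorProduct.tmul_mul_tmul, smul_mul_assoc, mul_smul_comm,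
        TensorProduct.ite_tmul, TensorProduct.tmul_ite, apply_ite (comulMap D), map_zero,
        map_smul]
      by_cases H : g = D.act h
      · simp [H, ← act_eq_iff]
        rw [Finset.smul_sum]
        refine Finset.sum_congr rfl fun p _ => ?_
        have hs := D.σ_mul p (p⁻¹ * D.act h)
        rw [mul_inv_cancel_left, map_mul, map_inv, D.act_act] at hs
        rw [hs, ← TensorProduct.smul_tmul']
        simp only [smul_smul]
        congr 1
        ring
      · simp only [H, if_false]
        refine (Finset.sum_eq_zero fun p _ => Finset.sum_eq_zero fun q _ => ?_).symm
        split_ifs with h₁ h₂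
        · subst h₂
          simp only [map_mul, map_inv] at h₁
          exact absurd (mul_left_cancel h₁) H
        all_goals simp
  have h₁ : ∀ v', ((∃ g, v' = e D g) ∨ ∃ g, v' = ex D g) →
      comulMap D ∘ₗ LinearMap.mulRight k v' =
        LinearMap.mulRight k (comulMap D v') ∘ₗ comulMap D := fun v' hv' =>
    hom_ext (fun g => key _ _ (.inl ⟨g, rfl⟩) hv') (fun g => key _ _ (.inr ⟨g, rfl⟩) hv')
  have h₂ : comulMap D ∘ₗ LinearMap.mulLeft k u =
        LinearMap.mulLeft k (comulMap D u) ∘ₗ comulMap D :=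
    hom_ext (fun g => LinearMap.congr_fun (h₁ _ (.inl ⟨g, rfl⟩)) u)
      (fun g => LinearMap.congr_fun (h₁ _ (.inr ⟨g, rfl⟩)) u)
  exact LinearMap.congr_fun h₂ v

theorem counitMap_one : counitMap D (1 : ExtAlg D) = 1 := by
  simp [counitMap, dualE, dualX]

theorem counitMap_mul (u v : ExtAlg D) :
    counitMap D (u * v) = counitMap D u * counitMap D v := by
  simp [counitMap, dualE, dualX, D.σ_one]
  ring

noncomputable instance : Bialgebra k (ExtAlg D) :=
  Bialgebra.mk' k (ExtAlg D) counitMap_one (counitMap_mul _ _) comulMap_one (comulMap_mul _ _)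

noncomputable instance : HopfAlgebra k (ExtAlg D) where
  antipode := antipodeMap D
  mul_antipode_rTensor_comul := by
    apply hom_ext <;> intro g
    · simp [comul_def, counit_def, comulMap_e, counitMap_e, antipodeMap_e, e_mul_e,
        eq_comm (a := (1 : G))]
      split_ifs
      · rw [one_eq_sum]
        exact Equiv.sum_comp (Equiv.inv G) (fun p => e D p)
      · simp
    · simp [comul_def, counit_def, comulMap_ex, counitMap_ex, antipodeMap_ex, ex_mul_ex,
        eq_comm (a := (1 : G))]
      split_ifs with H
      · subst H
        rw [one_eq_sum, ← Equiv.sum_comp ((Equiv.inv G).trans D.act.toEquiv)]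
        refine Finset.sum_congr rfl fun p _ => ?_
        have h := congrArg Units.val (D.τ_inv_comm (D.act p⁻¹))
        simp only [map_inv, inv_inv] at h
        simp only [mul_one, smul_smul, map_inv, inv_inv, D.act_act, D.σ_act, h,
          Equiv.trans_apply, Equiv.inv_apply, MulEquiv.toEquiv_eq_coe, MulEquiv.coe_toEquiv]
        convert one_smul k _ using 2
        field_simp
      · simp
  mul_antipode_lTensor_comul := by
    apply hom_ext <;> intro g
    · simp [comul_def, counit_def, comulMap_e, counitMap_e, antipodeMap_e, e_mul_e,
        eq_comm (a := (1 : G))]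
      split_ifs
      · rw [one_eq_sum]
      · simp
    · simp only [comul_def, counit_def, comulMap_ex, counitMap_ex, antipodeMap_ex, ex_mul_ex,
        LinearMap.comp_apply, map_sum, map_smul, LinearMap.lTensor_tmul, LinearMap.mul'_apply,
        mul_smul_comm, D.act_act, mul_inv_rev, inv_inv, eq_comm (a := (1 : G)),
        Algebra.linearMap_apply, eq_inv_mul_iff_mul_eq, mul_eq_right, apply_ite (algebraMap k _)]
      split_ifs with H
      · subst H
        rw [map_one, one_eq_sum]
        refine Finset.sum_congr rfl fun p _ => ?_
        simp only [smul_smul, mul_one, inv_one, one_mul]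
        convert one_smul k _ using 2
        push_cast
        field_simp
      · simp

/-- `Δ(x) = [∑ g h, τ(g,h) e_g ⊗ e_h] (x ⊗ x)`. -/
theorem comul_x : Coalgebra.comul (R := k) (x D) =
    (∑ g, ∑ h, (D.τ g h : k) • e D g ⊗ₜ[k] e D h) * x D ⊗ₜ[k] x D := by
  have hx : x D = ∑ g, ex D g := by
    apply ext' <;> intro h <;> simp [coE_sum, coX_sum]
  conv_lhs => rw [hx]
  simp only [comul_def, map_sum, comulMap_ex, Finset.sum_mul, smul_mul_assoc,
    Algebra.TensorProduct.tmul_mul_tmul, e_mul_x]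
  rw [Finset.sum_comm]
  refine Finset.sum_congr rfl fun p _ => ?_
  rw [← Equiv.sum_comp (Equiv.mulLeft p)]
  simp

end

end ExtAlg

/-! ## The Hopf algebras `K(8n,σ,τ)` -/

namespace K8n

/-- The group `G = ℤ_{2n} × ℤ₂ = ⟨a, b | a^{2n} = b² = 1, ab = ba⟩`. -/
abbrev Grp (n : ℕ) : Type := Multiplicative (ZMod (2 * n)) × Multiplicative (ZMod 2)

/-- The generator `a`. -/
def a (n : ℕ) : Grp n := (Multiplicative.ofAdd 1, 1)

/-- The generator `b`. -/
def b (n : ℕ) : Grp n := (1, Multiplicative.ofAdd 1)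

/-- The data `(G, ◁, σ, τ)` is that of a `K(8n,σ,τ)`: `a ◁ x = ab` and `b ◁ x = b`. -/
structure IsK8n {k : Type*} [Field k] {n : ℕ} (D : ExtData k (Grp n)) : Prop where
  act_a : D.act (a n) = a n * b n
  act_b : D.act (b n) = b n

/-- `η(g,h) = τ(g,h) τ(h,g)⁻¹`. -/
def η {k G : Type*} [Field k] [CommGroup G] (D : ExtData k G) (g h : G) : kˣ :=
  D.τ g h * (D.τ h g)⁻¹

section

variable {k : Type*} [Field k] {n : ℕ} (D : ExtData k (Grp n))

/-- `P_i = ∏_{k=1}^{i-1} τ(a, a^k)`, with `P_0 = P_1 = 1`. -/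
def P (i : ℕ) : k := ∏ m ∈ Finset.Ico 1 i, (D.τ (a n) (a n ^ m) : k)

/-- `λ_{2i,j} = P_{2i}⁻¹ σ(a^j)^i` and `λ_{2i+1,j} = P_{2i+1}⁻¹ σ(a^j)^i`. -/
def lam (m j : ℕ) : k := (P D m)⁻¹ * (D.σ (a n ^ j) : k) ^ (m / 2)

/-- `h(t₁,t₂) = τ(t₁,t₂) / τ(t₂ ◁ x, t₁ ◁ x)`. -/
def hFun (t₁ t₂ : Grp n) : k := (D.τ t₁ t₂ : k) / (D.τ (D.act t₂) (D.act t₁) : k)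

/-- `S_{j,0} = λ_{2j+1,1} α^{j+1} β^j`. -/
def S0 (α β : k) (j : ℕ) : k := lam D (2 * j + 1) 1 * α ^ (j + 1) * β ^ j

/-- `S_{j,1} = h(a, a^{2j+1} b) λ_{2j+1,1} α^j β^{j+1}`. -/
def S1 (α β : k) (j : ℕ) : k :=
  hFun D (a n) (a n ^ (2 * j + 1) * b n) * lam D (2 * j + 1) 1 * α ^ j * β ^ (j + 1)

open ExtAlg in
/-- The element `R'_{α,β}`. -/
noncomputable def R' (α β : k) : ExtAlg D ⊗[k] ExtAlg D :=
  ∑ i ∈ Finset.range n, ∑ j ∈ Finset.range n,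
    -- the values of `w¹` at `(a^{2i} b^p, a^{2j} b^q)`
    ((lam D (2 * j) 1 ^ (2 * i) * (α * β) ^ (2 * i * j) * (D.σ (a n ^ (2 * j)) : k) ^ i) •
        (e D (a n ^ (2 * i)) ⊗ₜ[k] e D (a n ^ (2 * j)) +
          e D (a n ^ (2 * i) * b n) ⊗ₜ[k] e D (a n ^ (2 * j)) +
          e D (a n ^ (2 * i)) ⊗ₜ[k] e D (a n ^ (2 * j) * b n) +
          e D (a n ^ (2 * i) * b n) ⊗ₜ[k] e D (a n ^ (2 * j) * b n)) +
      -- the values of `w²` at `(a^{2i} b^p, a^{2j+1} b^q)`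
      (lam D (2 * i) (2 * j + 1) * (S0 D α β j * S1 D α β j) ^ i) •
        (ex D (a n ^ (2 * i)) ⊗ₜ[k] e D (a n ^ (2 * j + 1)) +
          ex D (a n ^ (2 * i)) ⊗ₜ[k] e D (a n ^ (2 * j + 1) * b n)) +
      ((D.τ (b n) (a n) * β) / (D.τ (b n) (a n ^ (2 * i)) * α) *
          lam D (2 * i) (2 * j + 1) * (S0 D α β j * S1 D α β j) ^ i) •
        (ex D (a n ^ (2 * i) * b n) ⊗ₜ[k] e D (a n ^ (2 * j + 1)) +
          ex D (a n ^ (2 * i) * b n) ⊗ₜ[k] e D (a n ^ (2 * j + 1) * b n)) +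
      -- the values of `w³` at `(a^{2i+1} b^p, a^{2j} b^q)`
      (lam D (2 * j) (2 * i + 1) * (S0 D α β i * S1 D α β i) ^ j) •
        (e D (a n ^ (2 * i + 1)) ⊗ₜ[k] ex D (a n ^ (2 * j)) +
          e D (a n ^ (2 * i + 1) * b n) ⊗ₜ[k] ex D (a n ^ (2 * j))) +
      ((D.τ (b n) (a n) * β) / (D.τ (b n) (a n ^ (2 * j)) * α) *
          lam D (2 * j) (2 * i + 1) * (S0 D α β i * S1 D α β i) ^ j) •
        (e D (a n ^ (2 * i + 1)) ⊗ₜ[k] ex D (a n ^ (2 * j) * b n) +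
          e D (a n ^ (2 * i + 1) * b n) ⊗ₜ[k] ex D (a n ^ (2 * j) * b n)) +
      -- the values of `w⁴` at `(a^{2i+1} b^p, a^{2j+1} b^q)`
      lam D (2 * i + 1) (2 * j + 1) •
        ((S0 D α β j ^ (i + 1) * S1 D α β j ^ i) •
            ex D (a n ^ (2 * i + 1)) ⊗ₜ[k] ex D (a n ^ (2 * j + 1)) +
          (S0 D α β j ^ i * S1 D α β j ^ (i + 1)) •
            ex D (a n ^ (2 * i + 1)) ⊗ₜ[k] ex D (a n ^ (2 * j + 1) * b n) +
          (hFun D (a n ^ (2 * i + 1) * b n) (a n ^ (2 * j + 1)) *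
              S0 D α β j ^ i * S1 D α β j ^ (i + 1)) •
            ex D (a n ^ (2 * i + 1) * b n) ⊗ₜ[k] ex D (a n ^ (2 * j + 1)) +
          (hFun D (a n ^ (2 * i + 1) * b n) (a n ^ (2 * j + 1) * b n) *
              S0 D α β j ^ (i + 1) * S1 D α β j ^ i) •
            ex D (a n ^ (2 * i + 1) * b n) ⊗ₜ[k] ex D (a n ^ (2 * j + 1) * b n)))

end

/-- The `w¹` block of `R`: the matrix, indexed by `S = {s | s ◁ x = s}`, of the coefficients
of `e_s ⊗ e_{s'}` in `R`. -/
noncomputable def w1Block {k G : Type*} [Field k] [CommGroup G] {D : ExtData k G}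
    (R : ExtAlg D ⊗[k] ExtAlg D) : Matrix {s : G // D.act s = s} {s : G // D.act s = s} k :=
  Matrix.of fun s s' =>
    TensorProduct.lid k k (TensorProduct.map (ExtAlg.dualE D s) (ExtAlg.dualE D s') R)

end K8n

/-! The first claim is an obstruction from cocommutativity. The cocycle identity makes `η`
multiplicative in each argument, and `η g g = 1`, so on a group generated by `a` and `b` the single
condition `η(a,b) = 1` forces `η` to be trivial (`τ_comm`). Then `τ` is symmetric and, `G` being
abelian, the coproduct is cocommutative.

For cocommutative `H` the two hexagon identities are invariant under flipping the legs to which `Δ`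
was applied, so `R₁₃` commutes with `R₂₃` and with `R₁₂`. Moreover `R` commutes with every `Δ(y)`,
so `R₁₂` commutes with `(Δ ⊗ id)(R) = R₁₃R₂₃`; cancelling the invertible `R₁₃` shows that `R₁₂`
commutes with `R₂₃`. Contracting these three relations with functionals shows that all elements of
`H_l` and `H_r` commute with one another. Minimality, `H = H_l H_r`, would thus make `H` commutative
(`IsMinimal.mul_comm`), whereas `x e_g = e_{g ◁ x} x` with a nontrivial action.

For the second claim, the coefficients `w¹(a^{2i} b^p, a^{2j} b^q)` do not depend on `p`, so the
rows of the block at `1` and at `b` coincide (`w1Block_R'_mul_b`). -/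

namespace Quasitriangular

/-! ### Contractions and flips of products of the legs of `R` -/

section

variable {k H : Type*} [Field k] [Ring H] [HopfAlgebra k H]

theorem lMap_tmul (x y : H) (f : Module.Dual k H) : lMap (x ⊗ₜ[k] y) f = f x • y := by
  simp [lMap]

theorem rMap_tmul (x y : H) (f : Module.Dual k H) : rMap (x ⊗ₜ[k] y) f = f y • x := by
  simp [rMap]

theorem lMap_zero (f : Module.Dual k H) : lMap (0 : H ⊗[k] H) f = 0 := by simp [lMap]

theorem rMap_zero (f : Module.Dual k H) : rMap (0 : H ⊗[k] H) f = 0 := by simp [rMap]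

theorem lMap_add (R S : H ⊗[k] H) (f : Module.Dual k H) :
    lMap (R + S) f = lMap R f + lMap S f := by simp [lMap]

theorem rMap_add (R S : H ⊗[k] H) (f : Module.Dual k H) :
    rMap (R + S) f = rMap R f + rMap S f := by simp [rMap]

/-- `f ⊗ g ⊗ id`. -/
noncomputable def contract12 (f g : Module.Dual k H) : (H ⊗[k] H) ⊗[k] H →ₗ[k] H :=
  (TensorProduct.lid k H).toLinearMap ∘ₗ
    TensorProduct.map ((TensorProduct.lid k k).toLinearMap ∘ₗ TensorProduct.map f g)
      LinearMap.id

/-- `id ⊗ f ⊗ g`. -/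
noncomputable def contract23 (f g : Module.Dual k H) : (H ⊗[k] H) ⊗[k] H →ₗ[k] H :=
  (TensorProduct.rid k H).toLinearMap ∘ₗ
    TensorProduct.map ((TensorProduct.rid k H).toLinearMap ∘ₗ TensorProduct.map LinearMap.id f) g

/-- `f ⊗ id ⊗ g`. -/
noncomputable def contract13 (f g : Module.Dual k H) : (H ⊗[k] H) ⊗[k] H →ₗ[k] H :=
  (TensorProduct.rid k H).toLinearMap ∘ₗ
    TensorProduct.map ((TensorProduct.lid k H).toLinearMap ∘ₗ TensorProduct.map f LinearMap.id) g

/-- The two factors overlap only in the third leg, so pairing off the other two legs leaves a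
product in `H` whose order is that of the factors. The five companion lemmas work the same way with
the shared leg varied or the order reversed; they turn commutation of legs into commutation in `H`.
-/
theorem contract12_leg13_mul_leg23 (f g : Module.Dual k H) (R S : H ⊗[k] H) :
    contract12 f g (leg13 R * leg23 S) = lMap R f * lMap S g := by
  induction R with
  | zero => simp [lMap_zero]
  | add R R' hR hR' => simp [lMap_add, add_mul, hR, hR']
  | tmul x y =>
    induction S with
    | zero => simp [lMap_zero]
    | add S S' hS hS' => simp only [map_add, lMap_add, mul_add, hS, hS']
    | tmul z w => simp [lMap_tmul, contract12, leg13, leg23, smul_smul, mul_comm]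

theorem contract12_leg23_mul_leg13 (f g : Module.Dual k H) (R S : H ⊗[k] H) :
    contract12 f g (leg23 S * leg13 R) = lMap S g * lMap R f := by
  induction R with
  | zero => simp [lMap_zero]
  | add R R' hR hR' => simp [lMap_add, mul_add, hR, hR']
  | tmul x y =>
    induction S with
    | zero => simp [lMap_zero]
    | add S S' hS hS' => simp only [map_add, lMap_add, add_mul, hS, hS']
    | tmul z w => simp [lMap_tmul, contract12, leg13, leg23, smul_smul]

theorem contract23_leg13_mul_leg12 (f g : Module.Dual k H) (R S : H ⊗[k] H) :
    contract23 f g (leg13 R * leg12 S) = rMap R g * rMap S f := by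
  induction R with
  | zero => simp [rMap_zero]
  | add R R' hR hR' => simp [rMap_add, add_mul, hR, hR']
  | tmul x y =>
    induction S with
    | zero => simp [rMap_zero]
    | add S S' hS hS' => simp only [map_add, rMap_add, mul_add, hS, hS']
    | tmul z w => simp [rMap_tmul, contract23, leg13, leg12, smul_smul, mul_comm]

theorem contract23_leg12_mul_leg13 (f g : Module.Dual k H) (R S : H ⊗[k] H) :
    contract23 f g (leg12 S * leg13 R) = rMap S f * rMap R g := by
  induction R with
  | zero => simp [rMap_zero]
  | add R R' hR hR' => simp [rMap_add, mul_add, hR, hR']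
  | tmul x y =>
    induction S with
    | zero => simp [rMap_zero]
    | add S S' hS hS' => simp only [map_add, rMap_add, add_mul, hS, hS']
    | tmul z w => simp [rMap_tmul, contract23, leg13, leg12, smul_smul, mul_comm]

theorem contract13_leg12_mul_leg23 (f g : Module.Dual k H) (R S : H ⊗[k] H) :
    contract13 f g (leg12 R * leg23 S) = lMap R f * rMap S g := by
  induction R with
  | zero => simp [lMap_zero]
  | add R R' hR hR' => simp [lMap_add, add_mul, hR, hR']
  | tmul x y =>
    induction S with
    | zero => simp [rMap_zero]
    | add S S' hS hS' => simp only [map_add, rMap_add, mul_add, hS, hS']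
    | tmul z w => simp [lMap_tmul, rMap_tmul, contract13, leg12, leg23, smul_smul, mul_comm]

theorem contract13_leg23_mul_leg12 (f g : Module.Dual k H) (R S : H ⊗[k] H) :
    contract13 f g (leg23 S * leg12 R) = rMap S g * lMap R f := by
  induction R with
  | zero => simp [lMap_zero]
  | add R R' hR hR' => simp [lMap_add, mul_add, hR, hR']
  | tmul x y =>
    induction S with
    | zero => simp [rMap_zero]
    | add S S' hS hS' => simp only [map_add, rMap_add, add_mul, hS, hS']
    | tmul z w => simp [lMap_tmul, rMap_tmul, contract13, leg12, leg23, smul_smul, mul_comm]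

theorem comm_leg13_mul_leg23 (R S : H ⊗[k] H) :
    (TensorProduct.comm k H H).toLinearMap.rTensor H (leg13 R * leg23 S) =
      leg23 R * leg13 S := by
  induction R with
  | zero => simp
  | add R R' hR hR' => simp [add_mul, hR, hR']
  | tmul x y =>
    induction S with
    | zero => simp
    | add S S' hS hS' => simp only [map_add, mul_add, hS, hS']
    | tmul z w => simp [leg13, leg23]

/-- The flip of legs 2 and 3 is conjugated by the associator because triple tensors are bracketed to
the left. -/
theorem comm_leg13_mul_leg12 (R S : H ⊗[k] H) :
    (TensorProduct.assoc k H H H).symm ((TensorProduct.comm k H H).toLinearMap.lTensor H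
      (TensorProduct.assoc k H H H (leg13 R * leg12 S))) = leg12 R * leg13 S := by
  induction R with
  | zero => simp
  | add R R' hR hR' => simp [add_mul, hR, hR']
  | tmul x y =>
    induction S with
    | zero => simp
    | add S S' hS hS' => simp only [map_add, mul_add, hS, hS']
    | tmul z w => simp [leg13, leg12]

/-! ### Cocommutative quasitriangular Hopf algebras -/

section Cocommutative

variable (hc : ∀ y : H, TensorProduct.comm k H H (Coalgebra.comul (R := k) y) =
  Coalgebra.comul (R := k) y)

include hc

/-- By cocommutativity `(Δ ⊗ id)(R)` is fixed by the flip of legs 1 and 2, which exchanges `R₁₃` and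
`R₂₃`. -/
theorem IsUniversalRMatrix.leg13_comm_leg23 {R : H ⊗[k] H} (hR : IsUniversalRMatrix R) :
    leg13 R * leg23 R = leg23 R * leg13 R := by
  have hc' : (TensorProduct.comm k H H).toLinearMap ∘ₗ Coalgebra.comul (R := k) (A := H) =
      Coalgebra.comul := LinearMap.ext hc
  rw [← comm_leg13_mul_leg23, ← hR.comul_id, ← LinearMap.comp_apply, ← LinearMap.rTensor_comp,
    hc']

theorem IsUniversalRMatrix.leg13_comm_leg12 {R : H ⊗[k] H} (hR : IsUniversalRMatrix R) :
    leg13 R * leg12 R = leg12 R * leg13 R := by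
  have hc' : (TensorProduct.comm k H H).toLinearMap ∘ₗ Coalgebra.comul (R := k) (A := H) =
      Coalgebra.comul := LinearMap.ext hc
  rw [← comm_leg13_mul_leg12, ← hR.id_comul, LinearEquiv.apply_symm_apply,
    ← LinearMap.comp_apply, ← LinearMap.lTensor_comp, hc']

/-- For cocommutative `H`, `R₁₂` commutes with `(Δ ⊗ id)(T)` for every `T`. -/
theorem IsUniversalRMatrix.leg12_comm_rTensor_comul {R : H ⊗[k] H} (hR : IsUniversalRMatrix R)
    (T : H ⊗[k] H) :
    leg12 R * (Coalgebra.comul (R := k) (A := H)).rTensor H T =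
      (Coalgebra.comul (R := k) (A := H)).rTensor H T * leg12 R := by
  induction T with
  | zero => simp
  | add T T' hT hT' => simp [mul_add, add_mul, hT, hT']
  | tmul x y =>
    have h := hR.comul_op x
    rw [hc] at h
    simp [leg12, h]

/-- `R₁₂` commutes with the product `R₁₃R₂₃` and with its first factor; since `R₁₃` is invertible,
it commutes with the second factor too. -/
theorem IsUniversalRMatrix.leg12_comm_leg23 {R : H ⊗[k] H} (hR : IsUniversalRMatrix R) :
    leg12 R * leg23 R = leg23 R * leg12 R := by
  have h := hR.leg12_comm_rTensor_comul hc R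
  rw [hR.comul_id, ← mul_assoc, ← hR.leg13_comm_leg12 hc, mul_assoc, mul_assoc] at h
  exact (hR.isUnit.map leg13).mul_left_cancel h

/-- A cocommutative minimal quasitriangular Hopf algebra is commutative. -/
theorem IsMinimal.mul_comm {R : H ⊗[k] H} (hR : IsMinimal R) (u v : H) : u * v = v * u := by
  have hU := hR.isUniversalRMatrix
  have hll (f g : Module.Dual k H) : Commute (lMap R f) (lMap R g) := by
    have h := congrArg (contract12 f g) (hU.leg13_comm_leg23 hc)
    rwa [contract12_leg13_mul_leg23, contract12_leg23_mul_leg13] at h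
  have hrr (f g : Module.Dual k H) : Commute (rMap R f) (rMap R g) := by
    -- The functionals are swapped because the first factor `R₁₃` is contracted in leg 3, the second
    -- factor `R₁₂` in leg 2.
    have h := congrArg (contract23 g f) (hU.leg13_comm_leg12 hc)
    rwa [contract23_leg13_mul_leg12, contract23_leg12_mul_leg13] at h
  have hlr (f g : Module.Dual k H) : Commute (lMap R f) (rMap R g) := by
    have h := congrArg (contract13 f g) (hU.leg12_comm_leg23 hc)
    rwa [contract13_leg12_mul_leg23, contract13_leg23_mul_leg12] at h
  -- Whatever commutes with both supports is central. Applied first to the elements of the supports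
  -- themselves and then to an arbitrary `v`.
  have key (y : H) (hl : ∀ f, Commute (lMap R f) y) (hr : ∀ f, Commute (rMap R f) y) (z : H) :
      Commute z y := by
    have hz : z ∈ leftSupport R * rightSupport R := hR.mul_eq_top ▸ Submodule.mem_top
    induction hz using Submodule.mul_induction_on' with
    | mem_mul_mem m hm n hn =>
      obtain ⟨f, rfl⟩ := hm
      obtain ⟨g, rfl⟩ := hn
      exact (hl f).mul_left (hr g)
    | add x _ y _ hx hy => exact hx.add_left hy
  exact key v (fun f => (key _ (fun g => hll g f) (fun g => (hlr f g).symm) v).symm)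
    (fun f => (key _ (fun g => hlr g f) (fun g => hrr g f) v).symm) u

end Cocommutative

end

end Quasitriangular

/-! ### Symmetric `τ`: cocommutativity and failure of minimality -/

namespace ExtAlg

section

variable {k G : Type*} [Field k] [CommGroup G] [DecidableEq G] [Fintype G] {D : ExtData k G}

theorem comm_comul (hτ : ∀ g h, D.τ g h = D.τ h g) (y : ExtAlg D) :
    TensorProduct.comm k (ExtAlg D) (ExtAlg D) (Coalgebra.comul (R := k) y) =
      Coalgebra.comul (R := k) y := by
  simp only [comul_def, comulMap, LinearMap.sum_apply, LinearMap.add_apply,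
    LinearMap.smul_apply, LinearMap.smulRight_apply, map_sum, map_add, map_smul,
    TensorProduct.comm_tmul]
  rw [Finset.sum_comm]
  refine Finset.sum_congr rfl fun h _ => Finset.sum_congr rfl fun l _ => ?_
  rw [mul_comm l h, hτ l h]

theorem isMinimalHopf_mul_comm (hc : ∀ y : ExtAlg D,
      TensorProduct.comm k (ExtAlg D) (ExtAlg D) (Coalgebra.comul (R := k) y) =
        Coalgebra.comul (R := k) y)
    (hH : Quasitriangular.IsMinimalHopf k (ExtAlg D)) (u v : ExtAlg D) : u * v = v * u := by
  obtain ⟨R, hR⟩ := hH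
  exact hR.mul_comm hc u v

/-- If `τ` is symmetric then `𝕜^G #_{σ,τ} 𝕜ℤ₂` is not minimal. -/
theorem not_isMinimalHopf (hτ : ∀ g h, D.τ g h = D.τ h g) :
    ¬ Quasitriangular.IsMinimalHopf k (ExtAlg D) := by
  intro hH
  obtain ⟨g, hg⟩ := D.act_ne
  have h := isMinimalHopf_mul_comm (comm_comul hτ) hH (x D) (e D g)
  rw [x_mul_e, e_mul_x, e_mul_x] at h
  -- The coefficient of `e_g x` is `0` in `e_{g ◁ x} x` and `1` in `e_g x`.
  have h' := congrArg (fun u => u.coX g) h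
  simp [Ne.symm hg] at h'

end

end ExtAlg

/-! ### The alternating bicharacter `η` -/

namespace K8n

section

variable {k G : Type*} [Field k] [CommGroup G] (D : ExtData k G)

/-- Combine the cocycle identities for the orderings `(g,h,l)`, `(g,l,h)` and `(l,g,h)`: since `G`
is abelian, the factor `τ(gl,h)` is common to the last two and is eliminated. -/
theorem η_mul_left (g h l : G) : η D (g * h) l = η D g l * η D h l := by
  have h₁ := D.τ_cocycle g h l
  have h₂ := D.τ_cocycle g l h
  have h₃ := D.τ_cocycle l g h
  rw [mul_comm l h] at h₂
  rw [mul_comm l g] at h₃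
  apply Units.ext
  have e₁ := congrArg Units.val h₁
  have e₂ := congrArg Units.val h₂
  have e₃ := congrArg Units.val h₃
  simp only [η, Units.val_mul, Units.val_inv_eq_inv_val] at e₁ e₂ e₃ ⊢
  have n₁ := (D.τ l (g * h)).ne_zero
  have n₂ := (D.τ l g).ne_zero
  have n₃ := (D.τ l h).ne_zero
  have n₄ := (D.τ g h).ne_zero
  have n₅ := (D.τ g (h * l)).ne_zero
  field_simp
  -- The extra nonzero factors `τ(g,h)` and `τ(g,hl)` make the goal a polynomial combination of the
  -- three identities.
  apply mul_left_cancel₀ n₄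
  apply mul_left_cancel₀ n₅
  linear_combination (D.τ g (h * l) * D.τ l g * D.τ l h : k) * e₁ -
    (D.τ h l * D.τ g (h * l) * D.τ l g : k) * e₂ +
    (D.τ h l * D.τ g (h * l) * D.τ g l : k) * e₃

theorem η_swap (g h : G) : η D h g = (η D g h)⁻¹ := by
  simp [η]

theorem η_self (g : G) : η D g g = 1 := by
  simp [η]

/-- The elements that commute with `l` in the twisted group algebra of `τ`. -/
def ηKer (l : G) : Subgroup G :=
  (MonoidHom.mk' (fun g => η D g l) fun g h => η_mul_left D g h l).ker

theorem mem_ηKer (g l : G) : g ∈ ηKer D l ↔ η D g l = 1 := Iff.rfl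

end

/-! ### Symmetry of `τ` on `ℤ_{2n} × ℤ₂`, and the `w¹` block -/

section

variable {n : ℕ}

theorem eq_pow_a_mul_pow_b [NeZero n] (g : Grp n) : ∃ i j : ℕ, g = a n ^ i * b n ^ j := by
  -- For `n = 0` the first factor would be `ℤ`, where `val` is the absolute value; hence `NeZero n`.
  refine ⟨(Multiplicative.toAdd g.1).val, (Multiplicative.toAdd g.2).val, ?_⟩
  ext
  · simp [a, b, ← ofAdd_nsmul]
  · simp [a, b, ← ofAdd_nsmul]

theorem b_ne_one : b n ≠ 1 := fun h => by
  have h' : (1 : ZMod 2) = 0 := congrArg (fun g : Grp n => Multiplicative.toAdd g.2) h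
  exact one_ne_zero h'

variable {k : Type*} [Field k] {D : ExtData k (Grp n)}

/-- Each `ηKer D l` is a subgroup, so it is everything once it contains `a` and `b`. This is used
for `l = a` and `l = b`, and then, exchanging the arguments of `η`, for arbitrary `l`. -/
theorem τ_comm [NeZero n] (hη : η D (a n) (b n) = 1) (g h : Grp n) : D.τ g h = D.τ h g := by
  have key (l : Grp n) (hA : a n ∈ ηKer D l) (hB : b n ∈ ηKer D l) (g : Grp n) :
      g ∈ ηKer D l := by
    obtain ⟨i, j, rfl⟩ := eq_pow_a_mul_pow_b g
    exact mul_mem (pow_mem hA i) (pow_mem hB j)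
  have flip {g l : Grp n} (H : g ∈ ηKer D l) : l ∈ ηKer D g := by
    rw [mem_ηKer] at H ⊢
    rw [η_swap, H, inv_one]
  have hA := key (a n) (η_self D _) (by exact flip hη)
  have hB := key (b n) hη (η_self D _)
  exact mul_inv_eq_one.mp (key h (flip (hA h)) (flip (hB h)) g)

/-- For fixed `i, j` the four `e ⊗ e` terms share one coefficient, and multiplication by `b` only
exchanges the first-leg indices `a^{2i}` and `a^{2i} b`. All other terms have some `e_g x` as a
factor and are killed by the functionals `dualE`. -/
theorem w1Block_R'_mul_b (α β : k) (s s' s'' : {s : Grp n // D.act s = s})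
    (h : (s' : Grp n) = s * b n) :
    w1Block (R' D α β) s s'' = w1Block (R' D α β) s' s'' := by
  have hb : b n * b n = 1 := by ext <;> simp [b]; rfl
  have h₁ (g : Grp n) : (s' : Grp n) = g * b n ↔ (s : Grp n) = g := by rw [h, mul_left_inj]
  have h₂ (g : Grp n) : (s : Grp n) = g * b n ↔ (s' : Grp n) = g := by
    rw [h, ← mul_left_inj (b n) (c := g), mul_assoc, hb, mul_one]
  simp only [w1Block, R', Matrix.of_apply, map_sum, map_add, map_smul, TensorProduct.map_tmul,
    ExtAlg.dualE_e, ExtAlg.dualE_ex, TensorProduct.zero_tmul, TensorProduct.tmul_zero,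
    TensorProduct.lid_tmul, h₁, h₂]
  refine Finset.sum_congr rfl fun i _ => Finset.sum_congr rfl fun j _ => ?_
  congr 1
  ring_nf

end

end K8n

theorem mainTheorem10 {k : Type*} [Field k] [IsAlgClosed k] [CharZero k] (n : ℕ) [NeZero n]
    (D : ExtData k (K8n.Grp n)) (hD : K8n.IsK8n D) (hη : K8n.η D (K8n.a n) (K8n.b n) = 1) :
    ¬ Quasitriangular.IsMinimalHopf k (ExtAlg D) ∧
      ∀ α β : k, (α * β) ^ n * K8n.lam D (2 * n) 1 = 1 →
        β ^ 2 / α ^ 2 = D.τ (K8n.b n) (K8n.b n) / (D.τ (K8n.b n) (K8n.a n) : k) ^ 2 →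
        (K8n.w1Block (K8n.R' D α β)).det = 0 := by
  refine ⟨ExtAlg.not_isMinimalHopf (K8n.τ_comm hη), fun α β _ _ => ?_⟩
  -- The two equal rows: `1` and `b` are distinct fixed points of the action that differ by the
  -- factor `b`.
  let s₁ : {s : K8n.Grp n // D.act s = s} := ⟨1, map_one D.act⟩
  let s₂ : {s : K8n.Grp n // D.act s = s} := ⟨K8n.b n, hD.act_b⟩
  have hne : s₁ ≠ s₂ := fun h => K8n.b_ne_one (congrArg Subtype.val h).symm
  have hb : (s₂ : K8n.Grp n) = s₁ * K8n.b n := (one_mul (K8n.b n)).symm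
  generalize s₁ = s at hne hb
  generalize s₂ = s' at hne hb
  exact Matrix.det_zero_of_row_eq hne
    (funext fun s'' => K8n.w1Block_R'_mul_b α β s s' s'' hb)
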